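/- A Conway algebra $\mathcal A=(A;a_1,a_2,\ldots,|,*)$ is a set $A$ with fixed elements $a_1,a_2,\ldots\in A$ and two binary operations $|,*$ on $A$ such that, for all $n\ge 1$ and $a,b,c,d\in A$: $a_n|a_{n+1}=a_n$, $a_n*a_{n+1}=a_n$, $(a|b)|(c|d)=(a|c)|(b|d)$, $(a|b)*(c|d)=(a*c)|(b*d)$, $(a*b)*(c*d)=(a*c)*(b*d)$, $(a|b)*b=a$, $(a*b)|b=a$. The invariant yielded by $\mathcal A$ is the isotopy invariant $w$ of oriented links with values in $A$ such that $w_{T_n}=a_n$ for the trivial link $T_n$ of $n\ge 1$ components, and $w_{L_+}=w_{L_-}|w_{L_0}$ and $w_{L_-}=w_{L_+}*w_{L_0}$ whenever $L_+,L_-,L_0$ are oriented link diagrams that are identical except near one crossing, which is positive in $L_+$, negative in $L_-$, and smoothed according to the orientation in $L_0$. Theorem. Let $\sigma_1,\sigma_2$ be the standard generators of the 3-string braid group, let $k\ge 0$, and let $a_1,\dots,a_{2k}\in\mathbb Z$ (these exponents are unrelated to the fixed elements of a Conway algebra) satisfy $\sum_{i=1}^{2k}a_i=0$. Let $\gamma=\sigma_1^{a_1}\sigma_2^{a_2}\cdots\sigma_1^{a_{2k-1}}\sigma_2^{a_{2k}}$.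 Then the closed braid $\hat\gamma$ cannot be distinguished from its mirror image by the invariant yielded by any Conway algebra: for every Conway algebra $\mathcal A$, the invariant $w$ yielded by $\mathcal A$ takes the same value on $\hat\gamma$ and on its mirror image. -/

import Mathlib

/-! ### Conway algebras -/

/-- A Conway algebra with universum `A`: fixed elements `a 1, a 2, …` and two binary operations,
`bar x y` for `x | y` and `star x y` for `x ∗ y`. -/
structure ConwayAlgebra (A : Type*) where
  a : ℕ+ → A
  bar : A → A → A
  star : A → A → A
  C1 : ∀ n, bar (a n) (a (n + 1)) = a n
  C2 : ∀ n, star (a n) (a (n + 1)) = a n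
  C3 : ∀ x y z t, bar (bar x y) (bar z t) = bar (bar x z) (bar y t)
  C4 : ∀ x y z t, star (bar x y) (bar z t) = bar (star x z) (star y t)
  C5 : ∀ x y z t, star (star x y) (star z t) = star (star x z) (star y t)
  C6 : ∀ x y, star (bar x y) y = x
  C7 : ∀ x y, bar (star x y) y = x

/-! ### Oriented link diagrams

A plane link diagram in general position with respect to the height function is cut by horizontal
lines into layers; each layer has exactly one local maximum, local minimum or crossing, and
otherwise vertical strands. We read from top to bottom. The strands met by a horizontal line,
from left to right, are recorded by a list of directions: `true` is down, `false` is up. -/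

/-- The elementary pieces of a diagram: a local maximum `∩`, whose left leg has direction `d` (and
whose right leg has the opposite one); a local minimum `∪`; a crossing, in which the strand from
the upper left to the lower right is the overcrossing one iff `o = true`. -/
inductive Piece where
  | cap (d : Bool)
  | cup
  | cross (o : Bool)
  deriving DecidableEq

namespace Piece

/-- Number of strands entering the piece from above. -/
def inputs : Piece → ℕ
  | cap _ => 0
  | cup => 2
  | cross _ => 2

/-- Number of strands leaving the piece below. -/
def outputs : Piece → ℕ
  | cap _ => 2
  | cup => 0
  | cross _ => 2

/-- The directions below the piece, placed at the far left, in terms of those above it; `none` if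
the piece does not fit. -/
def act : Piece → List Bool → Option (List Bool)
  | cap d, s => some (d :: (!d) :: s)
  | cup, x :: y :: s => if x = y then none else some s
  | cross _, x :: y :: s => some (y :: x :: s)
  | _, _ => none

/-- The same with `i` vertical strands to the left of the piece. -/
def actAt (p : Piece) : ℕ → List Bool → Option (List Bool)
  | 0, s => p.act s
  | i + 1, x :: s => (p.actAt i s).map (x :: ·)
  | _ + 1, [] => none

/-- Mirror image in the plane of the diagram: over and under are exchanged. -/
def mirror : Piece → Piece
  | cap d => cap d
  | cup => cup
  | cross o => cross (!o)

end Piece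

/-- A layer: a piece with `pos` strands to its left. -/
structure Layer where
  pos : ℕ
  piece : Piece
  deriving DecidableEq

/-- Passing from the directions above a stack of layers to those below it. -/
def runLayers : List Layer → List Bool → Option (List Bool)
  | [], s => some s
  | e :: es, s => (e.piece.actAt e.pos s).bind (runLayers es)

/-- A diagram of an oriented link: a stack of layers that fit together, with no strands at the top
and at the bottom. -/
structure LinkDiagram where
  word : List Layer
  closed : runLayers word [] = some []

namespace LinkDiagram

/-- The local moves between stacks of layers: plane isotopy (the first five) and the Reidemeister
moves. Orientations are arbitrary; they have to fit because a move is applied only when both sides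
are diagrams. -/
inductive LocalMove : List Layer → List Layer → Prop
  /-- change of the heights of two pieces, `p` to the left of `q` -/
  | exchange (i g : ℕ) (p q : Piece) :
      LocalMove [⟨i, p⟩, ⟨i + g + p.outputs, q⟩] [⟨i + g + p.inputs, q⟩, ⟨i, p⟩]
  /-- cancellation of a maximum with a minimum -/
  | zigzagLeft (i : ℕ) (d : Bool) : LocalMove [⟨i + 1, .cap d⟩, ⟨i, .cup⟩] []
  | zigzagRight (i : ℕ) (d : Bool) : LocalMove [⟨i, .cap d⟩, ⟨i + 1, .cup⟩] []
  /-- a strand above or below a maximum or minimum swings from one leg to the other -/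
  | swingCap (i : ℕ) (d o : Bool) :
      LocalMove [⟨i + 1, .cap d⟩, ⟨i, .cross o⟩] [⟨i, .cap d⟩, ⟨i + 1, .cross (!o)⟩]
  | swingCup (i : ℕ) (o : Bool) :
      LocalMove [⟨i, .cross o⟩, ⟨i + 1, .cup⟩] [⟨i + 1, .cross (!o)⟩, ⟨i, .cup⟩]
  /-- first Reidemeister move: a curl at a maximum or minimum -/
  | reidemeister1Cap (i : ℕ) (d o : Bool) :
      LocalMove [⟨i, .cap d⟩, ⟨i, .cross o⟩] [⟨i, .cap (!d)⟩]
  | reidemeister1Cup (i : ℕ) (o : Bool) :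
      LocalMove [⟨i, .cross o⟩, ⟨i, .cup⟩] [⟨i, .cup⟩]
  /-- second Reidemeister move -/
  | reidemeister2 (i : ℕ) (o : Bool) :
      LocalMove [⟨i, .cross o⟩, ⟨i, .cross (!o)⟩] []
  /-- third Reidemeister move; the condition says that one of the three strands is above the
  other two, which excludes the cyclic patterns -/
  | reidemeister3 (i : ℕ) (o₁ o₂ o₃ : Bool) (h : o₂ = o₁ ∨ o₂ = o₃) :
      LocalMove [⟨i, .cross o₁⟩, ⟨i + 1, .cross o₂⟩, ⟨i, .cross o₃⟩]
        [⟨i + 1, .cross o₃⟩, ⟨i, .cross o₂⟩, ⟨i + 1, .cross o₁⟩]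

/-- `D'` is obtained from `D` by one local move. -/
def Move (D D' : LinkDiagram) : Prop :=
  ∃ u v x y, LocalMove x y ∧ D.word = u ++ x ++ v ∧ D'.word = u ++ y ++ v

/-- `Skein L₊ L₋ L₀`: the three diagrams are identical except near one crossing, which is positive
in `L₊`, negative in `L₋`, and smoothed according to the orientation in `L₀`. If the two strands,
with directions `x` and `y` above the crossing, are both directed down or both up, then the
positive crossing is `cross false` and the smoothing consists of two vertical strands. If one is
directed down and the other one up, then the positive crossing is `cross true` and the smoothing
consists of a minimum and a maximum below it. -/
def Skein (Lpos Lneg Lzero : LinkDiagram) : Prop :=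
  ∃ (u v : List Layer) (s : List Bool) (i : ℕ) (x y : Bool),
    runLayers u [] = some s ∧ s[i]? = some x ∧ s[i + 1]? = some y ∧
    Lpos.word = u ++ [⟨i, .cross (x != y)⟩] ++ v ∧
    Lneg.word = u ++ [⟨i, .cross (!(x != y))⟩] ++ v ∧
    Lzero.word = u ++ (if x = y then [] else [⟨i, .cup⟩, ⟨i, .cap y⟩]) ++ v

theorem runLayers_append (u v : List Layer) (s : List Bool) :
    runLayers (u ++ v) s = (runLayers u s).bind (runLayers v) := by
  induction u generalizing s with
  | nil => rfl
  | cons e u ih =>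
    simp only [List.cons_append, runLayers, Option.bind_assoc]
    congr 1
    funext t
    exact ih t

/-- The crossing-free diagram of the trivial link of `n` components. -/
def trivialLink (n : ℕ) : LinkDiagram where
  word := (List.replicate n [⟨0, .cap true⟩, ⟨0, .cup⟩]).flatten
  closed := by
    induction n with
    | zero => rfl
    | succ n ih =>
      rw [List.replicate_succ, List.flatten_cons, runLayers_append]
      exact ih

theorem actAt_mirror (p : Piece) (i : ℕ) (s : List Bool) :
    p.mirror.actAt i s = p.actAt i s := by
  induction i generalizing s with
  | zero => cases p <;> rcases s with _ | ⟨x, _ | ⟨y, s⟩⟩ <;> rfl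
  | succ i ih => cases s <;> simp [Piece.actAt, ih]

theorem runLayers_mirror (u : List Layer) (s : List Bool) :
    runLayers (u.map fun e => ⟨e.pos, e.piece.mirror⟩) s = runLayers u s := by
  induction u generalizing s with
  | nil => rfl
  | cons e u ih =>
    simp only [List.map_cons, runLayers, actAt_mirror]
    congr 1
    funext t
    exact ih t

/-- The mirror image of a diagram: all crossings are changed. -/
def mirror (D : LinkDiagram) : LinkDiagram where
  word := D.word.map fun e => ⟨e.pos, e.piece.mirror⟩
  closed := by rw [runLayers_mirror, D.closed]

end LinkDiagram

/-- Isotopy classes of oriented links: diagrams up to the equivalence relation generated by the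
moves. -/
def OrientedLink : Type := Quot LinkDiagram.Move

/-- The isotopy class of the link given by a diagram. -/
def LinkDiagram.link (D : LinkDiagram) : OrientedLink := Quot.mk _ D

/-- `w` is the invariant of oriented links yielded by the Conway algebra: it satisfies the initial
conditions and the Conway relations. -/
structure ConwayAlgebra.Yields {A : Type*} (𝒜 : ConwayAlgebra A) (w : OrientedLink → A) :
    Prop where
  initial : ∀ n : ℕ+, w (LinkDiagram.trivialLink n).link = 𝒜.a n
  conway_pos : ∀ Lpos Lneg Lzero : LinkDiagram, LinkDiagram.Skein Lpos Lneg Lzero →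
    w Lpos.link = 𝒜.bar (w Lneg.link) (w Lzero.link)
  conway_neg : ∀ Lpos Lneg Lzero : LinkDiagram, LinkDiagram.Skein Lpos Lneg Lzero →
    w Lneg.link = 𝒜.star (w Lpos.link) (w Lzero.link)

/-! ### Closed 3-braids -/

/-- The letters `σ₁, σ₂` of 3-braid words are indexed by `0, 1 : Fin 2`. A braid word is a list of
letters and exponents. -/
abbrev BraidWord := List (Fin 2 × ℤ)

/-- The layers of `σ ^ e`: the strands are directed down, so that `σ` is a positive crossing and
`σ⁻¹` a negative one. -/
def braidSyllable (σ : Fin 2) (e : ℤ) : List Layer :=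
  List.replicate e.natAbs ⟨σ, .cross (decide (e < 0))⟩

def BraidWord.layers (γ : BraidWord) : List Layer :=
  (γ.map fun p => braidSyllable p.1 p.2).flatten

theorem runLayers_braidSyllable (σ : Fin 2) (e : ℤ) :
    runLayers (braidSyllable σ e) [true, true, true, false, false, false] =
      some [true, true, true, false, false, false] := by
  unfold braidSyllable
  generalize e.natAbs = n
  induction n with
  | zero => rfl
  | succ n ih =>
    rw [List.replicate_succ]
    fin_cases σ <;> exact ih

theorem BraidWord.runLayers_layers (γ : BraidWord) :
    runLayers γ.layers [true, true, true, false, false, false] =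
      some [true, true, true, false, false, false] := by
  induction γ with
  | nil => rfl
  | cons p γ ih =>
    have : BraidWord.layers (p :: γ) = braidSyllable p.1 p.2 ++ BraidWord.layers γ := by
      simp [BraidWord.layers]
    rw [this, LinkDiagram.runLayers_append, runLayers_braidSyllable]
    exact ih

/-- The closed braid: the three braid strands are joined by three nested arcs, which run up on the
right-hand side. -/
def BraidWord.closure (γ : BraidWord) : LinkDiagram where
  word := [⟨0, .cap true⟩, ⟨1, .cap true⟩, ⟨2, .cap true⟩] ++ γ.layers ++
    [⟨2, .cup⟩, ⟨1, .cup⟩, ⟨0, .cup⟩]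
  closed := by
    rw [LinkDiagram.runLayers_append, LinkDiagram.runLayers_append]
    have : runLayers [⟨0, .cap true⟩, ⟨1, .cap true⟩, ⟨2, .cap true⟩] [] =
      some [true, true, true, false, false, false] := rfl
    rw [this, Option.bind_some, BraidWord.runLayers_layers]
    rfl

/-- The word `σ₁^(a 0) σ₂^(a 1) σ₁^(a 2) ⋯ σ₁^(a (2k-2)) σ₂^(a (2k-1))`. -/
def alternatingBraid {k : ℕ} (a : Fin (2 * k) → ℤ) : BraidWord :=
  List.ofFn fun j => (if j.val % 2 = 0 then 0 else 1, a j)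

/-! Let R_y be the right translation t ↦ t | y, a bijection with inverse t ↦ t * y. The claim for
exponent sum 0 is not inductive by itself, since smoothing a negative crossing raises the exponent
sum by 1 and smoothing a positive one lowers it by 1. It is therefore proved together with a
companion for exponent sum 1: if x and x' are the values on a word and on its mirror image, then R_x
∘ R_x' = R_c ∘ R_c, where c is the value on the trivial link of two components. This pair of claims
is `MirrorSymmetric`, and the induction is on the number of letters.

The key step is `mirrorSymmetric_swap`. Exchanging the signs of two adjacent letters of opposite
sign changes the value by one translation and one inverse translation, whose parameters are values
on words with one letter less. For exponent sum 0, the companion claim for these words shows that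
the value of the mirror image undergoes the same bijection. For exponent sum 1, the parameters agree
for the word and its mirror image, and the law (a|b)|(c|d) = (a|c)|(b|d) leaves R_x ∘ R_x'
unchanged.

Hence the signs may be permuted freely while the generators stay in place. A suitable arrangement
either shortens the word by a cancellation or by the braid relation, or gives a closure that is a
trivial link. -/

/-! ### Translations in a Conway algebra -/

namespace ConwayAlgebra

variable {A : Type*} {𝒜 : ConwayAlgebra A}

variable (𝒜) in
/-- The right translations by `y` and `x` compose, in this order, to the square of the right
translation by `c`. -/
def Balanced (c x y : A) : Prop :=
  ∀ t, 𝒜.bar (𝒜.bar t y) x = 𝒜.bar (𝒜.bar t c) c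

/-- Both R_p' ∘ R_p and R_q' ∘ R_q equal R_c ∘ R_c. Cancelling R_q' on the left and R_p on the right
gives the identity. -/
theorem Balanced.bar_star_eq {c p q p' q' : A} (hp : 𝒜.Balanced c p' p)
    (hq : 𝒜.Balanced c q' q) (x : A) :
    𝒜.star (𝒜.bar x p') q' = 𝒜.bar (𝒜.star x p) q := by
  obtain ⟨y, rfl⟩ : ∃ y, 𝒜.bar y p = x := ⟨_, 𝒜.C7 x p⟩
  rw [hp, 𝒜.C6, ← hq y, 𝒜.C6]

/-- Right translations by `x'` and `x` have the same composite after `x` and `x'` are moved in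
opposite directions. -/
theorem bar_bar_bar_star (t x x' u v : A) :
    𝒜.bar (𝒜.bar t (𝒜.star (𝒜.bar x' u) v)) (𝒜.bar (𝒜.star x u) v) =
      𝒜.bar (𝒜.bar t x') x := by
  rw [𝒜.C3, 𝒜.C7, 𝒜.C3, 𝒜.C7]

theorem balanced_bar_star_iff {c x x' u v : A} :
    𝒜.Balanced c (𝒜.bar (𝒜.star x u) v) (𝒜.star (𝒜.bar x' u) v) ↔ 𝒜.Balanced c x x' := by
  simp only [Balanced, bar_bar_bar_star]

end ConwayAlgebra

/-! ### Words in the letters `σ₁^±1`, `σ₂^±1` -/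

/-- A word in the generators of the 3-braid group and their inverses; `(i, true)` is the inverse
of the generator `(i, false)`. -/
abbrev LetterWord := List (Fin 2 × Bool)

namespace LetterWord

/-- The directions of the strands of a closed 3-braid at the heights of its crossings. -/
abbrev strands : List Bool := [true, true, true, false, false, false]

abbrev caps : List Layer := [⟨0, .cap true⟩, ⟨1, .cap true⟩, ⟨2, .cap true⟩]

abbrev cups : List Layer := [⟨2, .cup⟩, ⟨1, .cup⟩, ⟨0, .cup⟩]

def layers (l : LetterWord) : List Layer :=
  l.map fun p => ⟨p.1, .cross p.2⟩

@[simp]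
theorem layers_append (l m : LetterWord) : layers (l ++ m) = layers l ++ layers m :=
  List.map_append

@[simp]
theorem layers_cons (p : Fin 2 × Bool) (l : LetterWord) :
    layers (p :: l) = ⟨p.1, .cross p.2⟩ :: layers l := rfl

@[simp]
theorem layers_nil : layers [] = [] := rfl

theorem runLayers_layers (l : LetterWord) : runLayers (layers l) strands = some strands := by
  induction l with
  | nil => rfl
  | cons p l ih =>
    obtain ⟨i, o⟩ := p
    fin_cases i <;> exact ih

def closure (l : LetterWord) : LinkDiagram where
  word := caps ++ layers l ++ cups
  closed := by
    rw [LinkDiagram.runLayers_append, LinkDiagram.runLayers_append]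
    have : runLayers caps [] = some strands := rfl
    rw [this, Option.bind_some, runLayers_layers]
    rfl

/-- The word with all letters inverted. -/
def mirror (l : LetterWord) : LetterWord :=
  l.map fun p => (p.1, !p.2)

@[simp]
theorem mirror_append (l m : LetterWord) : mirror (l ++ m) = mirror l ++ mirror m :=
  List.map_append

@[simp]
theorem mirror_cons (p : Fin 2 × Bool) (l : LetterWord) :
    mirror (p :: l) = (p.1, !p.2) :: mirror l := rfl

@[simp]
theorem mirror_nil : mirror [] = [] := rfl

/-- The exponent sum. -/
def exponent (l : LetterWord) : ℤ :=
  (l.map fun p => if p.2 then -1 else 1).sum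

@[simp]
theorem exponent_append (l m : LetterWord) : exponent (l ++ m) = exponent l + exponent m := by
  simp [exponent]

@[simp]
theorem exponent_cons (p : Fin 2 × Bool) (l : LetterWord) :
    exponent (p :: l) = (if p.2 then -1 else 1) + exponent l := by
  simp [exponent]

@[simp]
theorem exponent_nil : exponent [] = 0 := rfl

end LetterWord

/-! ### Isotopy of stacks of layers -/

namespace LinkDiagram

theorem ext_word {D D' : LinkDiagram} (h : D.word = D'.word) : D = D' := by
  cases D; cases D'; cases h; rfl

/-- Below a line with directions `s`, the stacks `x` and `y` may replace each other in every
diagram, up to isotopy. -/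
def Replaceable (s : List Bool) (x y : List Layer) : Prop :=
  runLayers x s = runLayers y s ∧ ∀ (D D' : LinkDiagram) (u v : List Layer),
    runLayers u [] = some s → D.word = u ++ x ++ v → D'.word = u ++ y ++ v → D.link = D'.link

namespace Replaceable

variable {s t : List Bool} {x y z u v : List Layer}

theorem symm (h : Replaceable s x y) : Replaceable s y x :=
  ⟨h.1.symm, fun D D' u v hu hD hD' => (h.2 D' D u v hu hD' hD).symm⟩

theorem trans (h : Replaceable s x y) (h' : Replaceable s y z) : Replaceable s x z := by
  refine ⟨h.1.trans h'.1, fun D D' u v hu hD hD' => ?_⟩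
  -- Moves relate closed diagrams only, so the intermediate stack must itself be one; equality of
  -- the `runLayers` values guarantees this.
  have hc : runLayers (u ++ y ++ v) [] = some [] := by
    have := D.closed
    rw [hD, runLayers_append, runLayers_append, hu, Option.bind_some, h.1] at this
    rw [runLayers_append, runLayers_append, hu, Option.bind_some, this]
  exact (h.2 D ⟨_, hc⟩ u v hu hD rfl).trans (h'.2 ⟨_, hc⟩ D' u v hu rfl hD')

theorem of_localMove (h : LocalMove x y) (hs : runLayers x s = runLayers y s) :
    Replaceable s x y :=
  ⟨hs, fun _ _ u v _ hD hD' => Quot.sound ⟨u, v, x, y, h, hD, hD'⟩⟩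

theorem congr (h : Replaceable t x y) (hu : runLayers u s = some t) (v : List Layer) :
    Replaceable s (u ++ x ++ v) (u ++ y ++ v) := by
  refine ⟨?_, fun D D' u' v' hu' hD hD' => h.2 D D' (u' ++ u) (v ++ v') ?_ ?_ ?_⟩
  · simp only [runLayers_append, hu, Option.bind_some, h.1]
  · rw [runLayers_append, hu', Option.bind_some, hu]
  · rw [hD]; simp only [List.append_assoc]
  · rw [hD']; simp only [List.append_assoc]

/-- One local move inside a stack. -/
theorem step (u v : List Layer) (h : LocalMove x y) (hu : runLayers u s = some t)
    (ht : runLayers x t = runLayers y t) : Replaceable s (u ++ x ++ v) (u ++ y ++ v) :=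
  (of_localMove h ht).congr hu v

theorem link_eq {D D' : LinkDiagram} (h : Replaceable [] D.word D'.word) : D.link = D'.link :=
  h.2 D D' [] [] rfl (by simp) (by simp)

end Replaceable

end LinkDiagram

/-! ### Isotopies of circles and curls -/

namespace LinkDiagram

open LocalMove Replaceable

/-- A circle passes through the strand on its left. -/
theorem replaceable_circle {p : List Bool} (hp : p.length < 2) (x : Bool) (r : List Bool) :
    Replaceable (p ++ x :: r) [⟨p.length + 1, .cap true⟩, ⟨p.length + 1, .cup⟩]
      [⟨p.length, .cap true⟩, ⟨p.length, .cup⟩] := by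
  rcases p with _ | ⟨y, _ | ⟨_, p⟩⟩
  · exact (step [⟨1, .cap true⟩] [⟨1, .cup⟩] (reidemeister2 0 true) rfl rfl).symm.trans <|
      (step [] [⟨0, .cross false⟩, ⟨1, .cup⟩] (swingCap 0 true true) rfl rfl).trans <|
      (step [⟨0, .cap true⟩, ⟨1, .cross false⟩] [] (swingCup 0 false) rfl rfl).trans <|
      step [⟨0, .cap true⟩] [⟨0, .cup⟩] (reidemeister2 1 false) rfl rfl
  · exact (step [⟨2, .cap true⟩] [⟨2, .cup⟩] (reidemeister2 1 true) rfl rfl).symm.trans <|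
      (step [] [⟨1, .cross false⟩, ⟨2, .cup⟩] (swingCap 1 true true) rfl rfl).trans <|
      (step [⟨1, .cap true⟩, ⟨2, .cross false⟩] [] (swingCup 1 false) rfl rfl).trans <|
      step [⟨1, .cap true⟩] [⟨1, .cup⟩] (reidemeister2 2 false) rfl rfl
  · simp at hp

/-- A curl in the second of two strands directed down. -/
theorem replaceable_curl (o : Bool) (s : List Bool) :
    Replaceable (true :: true :: s) [⟨2, .cap true⟩, ⟨1, .cross o⟩, ⟨2, .cup⟩] [] :=
  (step [] [⟨2, .cup⟩] (swingCap 1 true o) rfl rfl).trans <|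
    (step [⟨1, .cap true⟩] [] (reidemeister1Cup 2 (!o)) rfl rfl).trans <|
    of_localMove (zigzagRight 1 true) rfl

/-- A curl in the first strand, directed down. -/
theorem replaceable_curl_zero (o : Bool) (s : List Bool) :
    Replaceable (true :: s) [⟨1, .cap true⟩, ⟨0, .cross o⟩, ⟨1, .cup⟩] [] :=
  (step [] [⟨1, .cup⟩] (swingCap 0 true o) rfl rfl).trans <|
    (step [⟨0, .cap true⟩] [] (reidemeister1Cup 1 (!o)) rfl rfl).trans <|
    of_localMove (zigzagRight 0 true) rfl

/-- Two nested circles. -/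
theorem replaceable_nested :
    Replaceable [] [⟨0, .cap true⟩, ⟨1, .cap true⟩, ⟨1, .cup⟩, ⟨0, .cup⟩]
      (trivialLink 2).word :=
  ((replaceable_circle (p := []) (by simp) true [false]).congr (u := [⟨0, .cap true⟩]) rfl
      [⟨0, .cup⟩]).trans <|
    (step [⟨0, .cap true⟩, ⟨0, .cap true⟩] [] (exchange 0 0 .cup .cup) rfl rfl).trans <|
    step [⟨0, .cap true⟩] [⟨0, .cup⟩] (exchange 0 0 (.cap true) .cup) rfl rfl

theorem replaceable_cap_cross (o : Bool) (v : List Layer) :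
    Replaceable [] (⟨0, .cap true⟩ :: ⟨1, .cap true⟩ :: ⟨2, .cap true⟩ :: ⟨0, .cross o⟩ :: v)
      (⟨0, .cap true⟩ :: ⟨1, .cap true⟩ :: ⟨0, .cross o⟩ :: ⟨2, .cap true⟩ :: v) :=
  (step [⟨0, .cap true⟩, ⟨1, .cap true⟩] v (exchange 0 0 (.cross o) (.cap true)) rfl rfl).symm

/-- Closure of the 2-braid word `σ₁^±1`. -/
theorem replaceable_closure_two (o : Bool) :
    Replaceable [] [⟨0, .cap true⟩, ⟨1, .cap true⟩, ⟨0, .cross o⟩, ⟨1, .cup⟩, ⟨0, .cup⟩]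
      (trivialLink 1).word :=
  (replaceable_curl_zero o [false]).congr (u := [⟨0, .cap true⟩]) rfl [⟨0, .cup⟩]

end LinkDiagram

/-! ### Closures of short words, and braid relations -/

namespace LetterWord

open LinkDiagram LocalMove Replaceable

theorem link_closure_one (o : Bool) : (closure [(1, o)]).link = (trivialLink 2).link :=
  link_eq <| ((replaceable_curl o [false, false]).congr
    (u := [⟨0, .cap true⟩, ⟨1, .cap true⟩]) rfl [⟨1, .cup⟩, ⟨0, .cup⟩]).trans replaceable_nested

/-- The third strand closes up to a circle. It passes through the two strands on its left and then
sinks below the rest of the diagram, which is a circle with a curl. -/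
theorem link_closure_zero (o : Bool) : (closure [(0, o)]).link = (trivialLink 2).link :=
  link_eq <| (replaceable_cap_cross o cups).trans <|
    ((replaceable_circle (p := [true]) (by simp) true [false, false]).congr
      (u := [⟨0, .cap true⟩, ⟨1, .cap true⟩, ⟨0, .cross o⟩]) rfl [⟨1, .cup⟩, ⟨0, .cup⟩]).trans <|
    ((replaceable_circle (p := []) (by simp) true [true, false, false]).congr
      (u := [⟨0, .cap true⟩, ⟨1, .cap true⟩, ⟨0, .cross o⟩]) rfl [⟨1, .cup⟩, ⟨0, .cup⟩]).trans <|
    (step [⟨0, .cap true⟩, ⟨1, .cap true⟩, ⟨0, .cross o⟩, ⟨0, .cap true⟩] [⟨0, .cup⟩]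
      (exchange 0 1 .cup .cup) rfl rfl).trans <|
    (step [⟨0, .cap true⟩, ⟨1, .cap true⟩, ⟨0, .cross o⟩] [⟨0, .cup⟩, ⟨0, .cup⟩]
      (exchange 0 1 (.cap true) .cup) rfl rfl).trans <|
    (step [⟨0, .cap true⟩, ⟨1, .cap true⟩, ⟨0, .cross o⟩, ⟨1, .cup⟩, ⟨0, .cap true⟩] []
      (exchange 0 0 .cup .cup) rfl rfl).trans <|
    (step [⟨0, .cap true⟩, ⟨1, .cap true⟩, ⟨0, .cross o⟩, ⟨1, .cup⟩] [⟨0, .cup⟩]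
      (exchange 0 0 (.cap true) .cup) rfl rfl).trans <|
    (replaceable_closure_two o).congr (u := []) rfl [⟨0, .cap true⟩, ⟨0, .cup⟩]

theorem link_closure_zero_one (o o' : Bool) :
    (closure [(0, o), (1, o')]).link = (trivialLink 1).link :=
  link_eq <| (replaceable_cap_cross o _).trans <|
    ((replaceable_curl o' [false, false]).congr
      (u := [⟨0, .cap true⟩, ⟨1, .cap true⟩, ⟨0, .cross o⟩]) rfl
      [⟨1, .cup⟩, ⟨0, .cup⟩]).trans <| replaceable_closure_two o

theorem link_closure_one_zero (o o' : Bool) :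
    (closure [(1, o), (0, o')]).link = (trivialLink 1).link :=
  link_eq <| (step (caps ++ [⟨1, .cross o⟩]) [⟨1, .cup⟩, ⟨0, .cup⟩]
      (exchange 0 0 (.cross o') .cup) rfl rfl).trans <|
    ((replaceable_curl o [false, false]).congr
      (u := [⟨0, .cap true⟩, ⟨1, .cap true⟩]) rfl
      [⟨0, .cross o'⟩, ⟨1, .cup⟩, ⟨0, .cup⟩]).trans <| replaceable_closure_two o'

/-- The only crossing with the third strand is a curl. Once it is removed, the two outer letters
cancel and leave two nested circles. -/
theorem link_closure_conj_one (o o' : Bool) :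
    (closure [(0, o), (1, o'), (0, !o)]).link = (trivialLink 2).link :=
  link_eq <| (replaceable_cap_cross o _).trans <|
    (step [⟨0, .cap true⟩, ⟨1, .cap true⟩, ⟨0, .cross o⟩, ⟨2, .cap true⟩, ⟨1, .cross o'⟩]
      [⟨1, .cup⟩, ⟨0, .cup⟩] (exchange 0 0 (.cross !o) .cup) rfl rfl).trans <|
    ((replaceable_curl o' [false, false]).congr
      (u := [⟨0, .cap true⟩, ⟨1, .cap true⟩, ⟨0, .cross o⟩]) rfl
      [⟨0, .cross !o⟩, ⟨1, .cup⟩, ⟨0, .cup⟩]).trans <|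
    (step [⟨0, .cap true⟩, ⟨1, .cap true⟩] [⟨1, .cup⟩, ⟨0, .cup⟩]
      (reidemeister2 0 o) rfl rfl).trans replaceable_nested

/-- Replacing a part of a braid word. -/
theorem link_closure_congr {x y : LetterWord} (u v : LetterWord)
    (h : Replaceable strands (layers x) (layers y)) :
    (closure (u ++ x ++ v)).link = (closure (u ++ y ++ v)).link := by
  refine link_eq ?_
  have hu : runLayers (caps ++ layers u) [] = some strands := by
    rw [runLayers_append]
    exact runLayers_layers u
  simpa [closure] using h.congr hu (layers v ++ cups)

theorem link_closure_cancel (u v : LetterWord) (i : Fin 2) (o : Bool) :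
    (closure (u ++ [(i, o), (i, !o)] ++ v)).link = (closure (u ++ v)).link := by
  have h : Replaceable strands (layers [(i, o), (i, !o)]) (layers []) :=
    of_localMove (reidemeister2 i o) (by fin_cases i <;> rfl)
  simpa using link_closure_congr u v h

theorem link_closure_braid (u v : LetterWord) {i j : Fin 2} (hij : i ≠ j) (o : Bool) :
    (closure (u ++ [(i, o), (j, o), (i, !o)] ++ v)).link =
      (closure (u ++ [(j, !o), (i, o), (j, o)] ++ v)).link := by
  refine link_closure_congr u v ?_
  fin_cases i <;> fin_cases j
  · exact absurd rfl hij
  · exact of_localMove (reidemeister3 0 o o (!o) (.inl rfl)) rfl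
  · exact (of_localMove (reidemeister3 0 (!o) o o (.inr rfl)) rfl).symm
  · exact absurd rfl hij

theorem link_closure_singleton (i : Fin 2) (o : Bool) :
    (closure [(i, o)]).link = (trivialLink 2).link := by
  fin_cases i
  · exact link_closure_zero o
  · exact link_closure_one o

theorem link_closure_pair {i j : Fin 2} (hij : i ≠ j) (o o' : Bool) :
    (closure [(i, o), (j, o')]).link = (trivialLink 1).link := by
  fin_cases i <;> fin_cases j
  · exact absurd rfl hij
  · exact link_closure_zero_one o o'
  · exact link_closure_one_zero o o'
  · exact absurd rfl hij

theorem link_closure_conj {i j : Fin 2} (hij : i ≠ j) (o : Bool) :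
    (closure [(i, o), (j, o), (i, !o)]).link = (trivialLink 2).link := by
  fin_cases i <;> fin_cases j
  · exact absurd rfl hij
  · exact link_closure_conj_one o o
  -- The braid relation turns this word into a conjugate of a σ₂-letter by a σ₁-letter, so no
  -- general conjugation invariance is needed.
  · refine (link_closure_braid [] [] hij o).trans ?_
    simpa using link_closure_conj_one (!o) o
  · exact absurd rfl hij

/-- The braid relation rewrites the first three letters so that they end in the inverse of the
fourth, which then cancels. This is what shortens a word without equal neighbours. -/
theorem link_closure_commutator (u v : LetterWord) {i j : Fin 2} (hij : i ≠ j) (o : Bool) :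
    (closure (u ++ [(i, o), (j, o), (i, !o), (j, !o)] ++ v)).link =
      (closure (u ++ [(j, !o), (i, o)] ++ v)).link := by
  have h := link_closure_braid u ((j, !o) :: v) hij o
  have h' := link_closure_cancel (u ++ [(j, !o), (i, o)]) v j o
  simp only [List.append_assoc, List.cons_append, List.nil_append] at h h' ⊢
  exact h.trans h'

theorem skein_closure (u v : LetterWord) (i : Fin 2) :
    Skein (closure (u ++ (i, false) :: v)) (closure (u ++ (i, true) :: v)) (closure (u ++ v)) := by
  refine ⟨caps ++ layers u, layers v ++ cups, strands, i, true, true, ?_, ?_, ?_, ?_, ?_, ?_⟩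
  · rw [runLayers_append]
    exact runLayers_layers u
  · fin_cases i <;> rfl
  · fin_cases i <;> rfl
  all_goals simp [closure]

end LetterWord

/-! ### Mirror symmetry by induction on the length -/

namespace LetterWord

@[simp]
theorem mirror_mirror (l : LetterWord) : mirror (mirror l) = l := by
  simp [mirror, Function.comp_def]

@[simp]
theorem exponent_mirror (l : LetterWord) : exponent (mirror l) = -exponent l := by
  induction l with
  | nil => rfl
  | cons p l ih => obtain ⟨i, _ | _⟩ := p <;> simp [ih] <;> ring

theorem exponent_zip {is : List (Fin 2)} {s : List Bool} (h : is.length = s.length) :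
    exponent (is.zip s) = s.count false - s.count true := by
  induction s generalizing is with
  | nil => simp
  | cons b s ih =>
    rcases is with _ | ⟨i, is⟩
    · simp at h
    · have := ih (is := is) (by simpa using h)
      cases b <;> simp [this] <;> ring

/-- How the values of `w` on the closures of a word and of its mirror image are related if the
exponent sum is `0` or `1`. -/
def MirrorSymmetric {A : Type*} (𝒜 : ConwayAlgebra A) (w : OrientedLink → A) (l : LetterWord) :
    Prop :=
  (exponent l = 0 → w (closure l).link = w (closure (mirror l)).link) ∧
    (exponent l = 1 →
      𝒜.Balanced (𝒜.a 2) (w (closure l).link) (w (closure (mirror l)).link))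

section

variable {A : Type*} {𝒜 : ConwayAlgebra A} {w : OrientedLink → A}

theorem MirrorSymmetric.of_link_eq {l m : LetterWord} (h : MirrorSymmetric 𝒜 w m)
    (he : exponent l = exponent m) (hl : (closure l).link = (closure m).link)
    (hl' : (closure (mirror l)).link = (closure (mirror m)).link) : MirrorSymmetric 𝒜 w l := by
  unfold MirrorSymmetric
  rw [he, hl, hl']
  exact h

theorem mirrorSymmetric_of_eq {l : LetterWord}
    (h : w (closure l).link = w (closure (mirror l)).link) (he : exponent l ≠ 1) :
    MirrorSymmetric 𝒜 w l :=
  ⟨fun _ => h, fun h1 => absurd h1 he⟩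

theorem mirrorSymmetric_of_trivialLink_two (hw : 𝒜.Yields w) {l : LetterWord}
    (hl : (closure l).link = (LinkDiagram.trivialLink 2).link)
    (hl' : (closure (mirror l)).link = (LinkDiagram.trivialLink 2).link) :
    MirrorSymmetric 𝒜 w l := by
  have h : w (LinkDiagram.trivialLink 2).link = 𝒜.a 2 := hw.initial 2
  unfold MirrorSymmetric
  rw [hl, hl', h]
  exact ⟨fun _ => rfl, fun _ _ => rfl⟩

/-- The signs of two adjacent letters may be exchanged if mirror symmetry is known for shorter
words. -/
theorem mirrorSymmetric_swap (hw : 𝒜.Yields w) {n : ℕ}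
    (ih : ∀ l : LetterWord, l.length < n → MirrorSymmetric 𝒜 w l) (u v : LetterWord)
    (i j : Fin 2) (hn : (u ++ (i, false) :: (j, true) :: v).length = n) :
    MirrorSymmetric 𝒜 w (u ++ (i, false) :: (j, true) :: v) ↔
      MirrorSymmetric 𝒜 w (u ++ (i, true) :: (j, false) :: v) := by
  -- Both words differ by one crossing change from the word in which the two letters are negative;
  -- for `hG` the intermediate word has both letters positive. Mirroring exchanges the two routes.
  have hF : w (closure (u ++ (i, false) :: (j, true) :: v)).link =
      𝒜.bar (𝒜.star (w (closure (u ++ (i, true) :: (j, false) :: v)).link)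
        (w (closure (u ++ (i, true) :: v)).link)) (w (closure (u ++ (j, true) :: v)).link) := by
    have h := hw.conway_neg _ _ _ (skein_closure (u ++ [(i, true)]) v j)
    simp only [List.append_assoc, List.cons_append, List.nil_append] at h
    rw [hw.conway_pos _ _ _ (skein_closure u ((j, true) :: v) i), h]
  have hG (u v : LetterWord) : w (closure (u ++ (i, true) :: (j, false) :: v)).link =
      𝒜.star (𝒜.bar (w (closure (u ++ (i, false) :: (j, true) :: v)).link)
        (w (closure (u ++ (i, false) :: v)).link)) (w (closure (u ++ (j, false) :: v)).link) := by
    have h := hw.conway_pos _ _ _ (skein_closure (u ++ [(i, false)]) v j)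
    simp only [List.append_assoc, List.cons_append, List.nil_append] at h
    rw [hw.conway_neg _ _ _ (skein_closure u ((j, false) :: v) i), h]
  have hlen (k : Fin 2) (o : Bool) : (mirror u ++ (k, o) :: mirror v).length < n := by
    rw [← hn]
    simp [mirror]
  have hlen' (k : Fin 2) (o : Bool) : (u ++ (k, o) :: v).length < n := by
    rw [← hn]
    simp
  unfold MirrorSymmetric
  simp only [mirror_append, mirror_cons, exponent_append, exponent_cons, Bool.not_false,
    Bool.not_true, if_true, Bool.false_eq_true, if_false]
  refine and_congr ?_ ?_
  -- Exponent sum 0: the shorter words in `hF` have exponent sum -1, so the companion claim applies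
  -- to their mirror images.
  · have key (he : exponent u + exponent v = 0) := by
      have hb (k : Fin 2) : 𝒜.Balanced (𝒜.a 2)
          (w (closure (mirror u ++ (k, false) :: mirror v)).link)
          (w (closure (u ++ (k, true) :: v)).link) := by
        have := (ih _ (hlen k false)).2 (by simp; lia)
        simpa using this
      exact (hb i).bar_star_eq (hb j)
    constructor
    · intro h he
      have he' : exponent u + exponent v = 0 := by lia
      have h' := h (by lia)
      rw [hF, hG (mirror u) (mirror v), key he'] at h'
      have inj (x y t : A) (h : 𝒜.bar x t = 𝒜.bar y t) : x = y := by
        rw [← 𝒜.C6 x t, h, 𝒜.C6]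
      have inj' (x y t : A) (h : 𝒜.star x t = 𝒜.star y t) : x = y := by
        rw [← 𝒜.C7 x t, h, 𝒜.C7]
      exact inj' _ _ _ (inj _ _ _ h')
    · intro h he
      rw [hF, hG (mirror u) (mirror v), key (by lia), h (by lia)]
  -- Exponent sum 1: the shorter words in `hF` have exponent sum 0, so their values agree with those
  -- of their mirror images.
  · have key (he : exponent u + exponent v = 1) (k : Fin 2) :
        w (closure (u ++ (k, true) :: v)).link =
          w (closure (mirror u ++ (k, false) :: mirror v)).link := by
      have := (ih _ (hlen' k true)).1 (by simp; lia)
      simpa using this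
    constructor
    · intro h he
      have he' : exponent u + exponent v = 1 := by lia
      have h' := h (by lia)
      rw [hF, hG (mirror u) (mirror v), key he' i, key he' j] at h'
      exact ConwayAlgebra.balanced_bar_star_iff.1 h'
    · intro h he
      have he' : exponent u + exponent v = 1 := by lia
      rw [hF, hG (mirror u) (mirror v), key he' i, key he' j]
      exact ConwayAlgebra.balanced_bar_star_iff.2 (h (by lia))

/-- The signs of the letters may be permuted if mirror symmetry is known for shorter words. -/
theorem mirrorSymmetric_perm (hw : 𝒜.Yields w) {n : ℕ}
    (ih : ∀ l : LetterWord, l.length < n → MirrorSymmetric 𝒜 w l) {s s' : List Bool}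
    (hs : s.Perm s') : ∀ (u : LetterWord) (is : List (Fin 2)), is.length = s.length →
      (u ++ is.zip s).length = n →
      (MirrorSymmetric 𝒜 w (u ++ is.zip s) ↔ MirrorSymmetric 𝒜 w (u ++ is.zip s')) := by
  induction hs with
  | nil => simp
  | cons b _ hp =>
    rintro u (_ | ⟨i, is⟩) hi hn
    · simp at hi
    · simpa using hp (u ++ [(i, b)]) is (by simpa using hi) (by simpa using hn)
  | swap b c s =>
    rintro u (_ | ⟨i, _ | ⟨j, is⟩⟩) hi hn
    · simp at hi
    · simp at hi
    · cases b <;> cases c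
      · rfl
      · exact (mirrorSymmetric_swap hw ih u (is.zip s) i j (by simpa using hn)).symm
      · exact mirrorSymmetric_swap hw ih u (is.zip s) i j (by simpa using hn)
      · rfl
  | trans hp hq hp' hq' =>
    intro u is hi hn
    have hi' := hi.trans hp.length_eq
    refine (hp' u is hi hn).trans (hq' u is hi' ?_)
    rw [← hn]
    simp [hp.length_eq]

theorem mirrorSymmetric_cancel {n : ℕ}
    (ih : ∀ l : LetterWord, l.length < n → MirrorSymmetric 𝒜 w l) (u v : LetterWord) (i : Fin 2)
    (o : Bool) (hn : (u ++ [(i, o), (i, !o)] ++ v).length = n) :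
    MirrorSymmetric 𝒜 w (u ++ [(i, o), (i, !o)] ++ v) := by
  refine (ih (u ++ v) ?_).of_link_eq ?_ (link_closure_cancel u v i o) ?_
  · rw [← hn]
    simp
  · cases o <;> simp
  · simpa using link_closure_cancel (mirror u) (mirror v) i (!o)

/-- The generators are kept and the signs rearranged: equal neighbours receive opposite signs and
cancel. An alternating word of length at least four is made to begin with a commutator, and
alternating words of length at most three can be made to close to trivial links. -/
theorem mirrorSymmetric (hw : 𝒜.Yields w) (l : LetterWord) : MirrorSymmetric 𝒜 w l := by
  induction hn : l.length using Nat.strong_induction_on generalizing l with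
  | _ n ih =>
  replace ih : ∀ l : LetterWord, l.length < n → MirrorSymmetric 𝒜 w l :=
    fun l hl => ih _ hl l rfl
  obtain ⟨is, s, hlen, rfl⟩ : ∃ (is : List (Fin 2)) (s : List Bool), is.length = s.length ∧
      l = is.zip s :=
    ⟨l.unzip.1, l.unzip.2, by simp, (List.zip_unzip l).symm⟩
  by_cases he : exponent (is.zip s) = 0 ∨ exponent (is.zip s) = 1
  swap
  · exact ⟨fun h => absurd (.inl h) he, fun h => absurd (.inr h) he⟩
  rw [exponent_zip hlen] at he
  have hcount : s.count true + s.count false = s.length := List.count_true_add_count_false s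
  have hsn : s.length = n := by simpa [hlen] using hn
  have perm {s' : List Bool} (hs : s.Perm s') (h : MirrorSymmetric 𝒜 w (is.zip s')) :
      MirrorSymmetric 𝒜 w (is.zip s) :=
    (mirrorSymmetric_perm hw ih hs [] is hlen hn).2 h
  have cancel (u v : LetterWord) (i : Fin 2) (o : Bool)
      (hn : (u ++ [(i, o), (i, !o)] ++ v).length = n) :=
    mirrorSymmetric_cancel ih u v i o hn
  have eqv {s' : List Bool} (hs : s'.count true = s.count true)
      (hs' : s'.count false = s.count false) : s.Perm s' :=
    List.perm_iff_count.2 fun b => by cases b <;> simp [hs, hs']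
  rcases is with _ | ⟨i, _ | ⟨j, _ | ⟨k, _ | ⟨m, is⟩⟩⟩⟩
  · exact mirrorSymmetric_of_eq (by simp) (by simp)
  · simp only [List.length_cons, List.length_nil] at hlen
    refine perm (s' := [false]) (eqv (by simp; lia) (by simp; lia)) ?_
    exact mirrorSymmetric_of_trivialLink_two hw (link_closure_singleton i _)
      (link_closure_singleton i _)
  · simp only [List.length_cons, List.length_nil] at hlen
    refine perm (s' := [false, true]) (eqv (by simp; lia) (by simp; lia)) ?_
    by_cases hij : i = j
    · subst hij
      exact cancel [] [] i false (by simp; lia)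
    · refine mirrorSymmetric_of_eq ?_ (by simp)
      exact congrArg w ((link_closure_pair hij _ _).trans (link_closure_pair hij _ _).symm)
  · simp only [List.length_cons, List.length_nil] at hlen
    by_cases hij : i = j
    · subst hij
      refine perm (s' := [false, true, false]) (eqv (by simp; lia) (by simp; lia)) ?_
      exact cancel [] [(k, false)] i false (by simp; lia)
    refine perm (s' := [false, false, true]) (eqv (by simp; lia) (by simp; lia)) ?_
    by_cases hjk : j = k
    · subst hjk
      exact cancel [(i, false)] [] j false (by simp; lia)
    · obtain rfl : k = i := by lia
      exact mirrorSymmetric_of_trivialLink_two hw (link_closure_conj hij false)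
        (link_closure_conj hij true)
  · simp only [List.length_cons] at hlen
    -- The numbers of positive and negative letters differ by at most one, so a word of length at
    -- least four has two of each; `r` holds the remaining signs.
    obtain ⟨p, hp⟩ : ∃ p, s.count true = p + 2 := ⟨s.count true - 2, by lia⟩
    obtain ⟨q, hq⟩ : ∃ q, s.count false = q + 2 := ⟨s.count false - 2, by lia⟩
    set r := List.replicate p true ++ List.replicate q false with hr
    have hrt : r.count true = p := by simp [hr, List.count_replicate]
    have hrf : r.count false = q := by simp [hr, List.count_replicate]
    have hrl : r.length = p + q := by simp [hr]
    have hlen' : is.length = p + q := by lia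
    by_cases hij : i = j
    · subst hij
      refine perm (s' := false :: true :: false :: true :: r) (eqv (by simp; lia) (by simp; lia)) ?_
      exact cancel [] ((k, false) :: (m, true) :: is.zip r) i false (by simp; lia)
    by_cases hkm : k = m
    · subst hkm
      refine perm (s' := false :: true :: false :: true :: r) (eqv (by simp; lia) (by simp; lia)) ?_
      exact cancel [(i, false), (j, true)] (is.zip r) k false (by simp; lia)
    -- With these signs, equal middle generators cancel. Otherwise the generators alternate, and the
    -- first four letters form a commutator.
    refine perm (s' := false :: false :: true :: true :: r) (eqv (by simp; lia) (by simp; lia)) ?_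
    by_cases hjk : j = k
    · subst hjk
      exact cancel [(i, false)] ((m, true) :: is.zip r) j false (by simp; lia)
    · obtain rfl : k = i := by lia
      obtain rfl : m = j := by lia
      refine (ih ([(m, true), (k, false)] ++ is.zip r) (by simp; lia)).of_link_eq (by simp) ?_ ?_
      · exact link_closure_commutator [] (is.zip r) hij false
      · exact link_closure_commutator [] (mirror (is.zip r)) hij true

end

end LetterWord

/-! ### From braid words with exponents to letters -/

/-- The word with powers written out. -/
def BraidWord.toLetterWord (γ : BraidWord) : LetterWord :=
  (γ.map fun p => List.replicate p.2.natAbs (p.1, decide (p.2 < 0))).flatten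

theorem BraidWord.layers_toLetterWord (γ : BraidWord) : γ.toLetterWord.layers = γ.layers := by
  induction γ with
  | nil => rfl
  | cons p γ ih =>
    simp only [toLetterWord, layers, List.map_cons, List.flatten_cons, LetterWord.layers_append]
      at ih ⊢
    rw [ih]
    simp [LetterWord.layers, braidSyllable]

theorem BraidWord.exponent_toLetterWord (γ : BraidWord) :
    γ.toLetterWord.exponent = (γ.map Prod.snd).sum := by
  induction γ with
  | nil => rfl
  | cons p γ ih =>
    simp only [toLetterWord, List.map_cons, List.flatten_cons, LetterWord.exponent_append,
      List.sum_cons] at ih ⊢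
    rw [ih]
    simp only [LetterWord.exponent, List.map_replicate, List.sum_replicate, decide_eq_true_eq]
    split_ifs with h
    · simp [abs_of_neg h]
    · simp [abs_of_nonneg (not_lt.1 h)]

theorem LetterWord.closure_mirror (l : LetterWord) : l.mirror.closure = l.closure.mirror := by
  refine LinkDiagram.ext_word ?_
  simp [closure, LinkDiagram.mirror, mirror, layers, Piece.mirror, Function.comp_def]

theorem BraidWord.closure_toLetterWord (γ : BraidWord) : γ.toLetterWord.closure = γ.closure :=
  LinkDiagram.ext_word <| by
    simp only [LetterWord.closure, closure, γ.layers_toLetterWord]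

theorem theorem3p29 {A : Type*} (𝒜 : ConwayAlgebra A) (w : OrientedLink → A) (hw : 𝒜.Yields w)
    (k : ℕ) (a : Fin (2 * k) → ℤ) (ha : ∑ j, a j = 0) :
    w (alternatingBraid a).closure.link = w (alternatingBraid a).closure.mirror.link := by
  rw [← BraidWord.closure_toLetterWord, ← LetterWord.closure_mirror]
  refine (LetterWord.mirrorSymmetric hw _).1 ?_
  rw [BraidWord.exponent_toLetterWord, ← ha, alternatingBraid, List.map_ofFn, List.sum_ofFn]
  rfl
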